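/- All groups are finite and all characters are complex. Let $\operatorname{Irr}(G)$ denote the set of irreducible characters of $G$; a character $\lambda$ is linear if $\lambda(1)=1$; for $\theta$ a character of a subgroup $H\leqslant G$, $\theta^G$ denotes the induced character; and for a character $\chi$ of $G$, $\operatorname{Cons}(\chi)=\{\phi\in\operatorname{Irr}(G) : \langle\phi,\chi\rangle>0\}$ is its set of irreducible constituents. A group $G$ is called \emph{almost monomial} if for any $\chi\neq\phi$ in $\operatorname{Irr}(G)$ there exist a subgroup $H\leqslant G$ and a linear character $\lambda$ of $H$ such that $\chi\in\operatorname{Cons}(\lambda^G)$ and $\phi\notin\operatorname{Cons}(\lambda^G)$. If $N\unlhd G$, then $G$ is called \emph{relative almost monomial} with respect to $N$ if for any $\chi\neq\phi$ in $\operatorname{Irr}(G)$ there exist a subgroup $H$ with $N\subseteq H\subseteq G$ and $\psi\in\operatorname{Irr}(H)$ such that the restriction $\psi_N$ is irreducible, $\chi\in\operatorname{Cons}(\psi^G)$ and $\phi\notin\operatorname{Cons}(\psi^G)$. Theorem. Let $N\unlhd G$ be a normal subgroup of the finite group $G$ and assume that all Sylow subgroups of $N$ are abelian. Assume that $G$ is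 solvable and is relative almost monomial with respect to $N$. Then $G$ is almost monomial. -/

import Mathlib

namespace AlmostMonomial

/-- `χ` is the character of a (nonzero, finite-dimensional) complex representation of `G`. -/
def IsCharacter {G : Type*} [Group G] (χ : G → ℂ) : Prop :=
  ∃ (n : ℕ) (ρ : Representation ℂ G (Fin n → ℂ)), 0 < n ∧ ρ.character = χ

/-- `Irr(G)`: the set of characters of the irreducible complex representations of the
finite group `G`. -/
def Irr (G : Type*) [Group G] [Finite G] : Set (G → ℂ) :=
  {χ | ∃ (n : ℕ) (ρ : Representation ℂ G (Fin n → ℂ)), ρ.IsIrreducible ∧ ρ.character = χ}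

/-- A linear character is a character of degree one. -/
def IsLinearCharacter {G : Type*} [Group G] (χ : G → ℂ) : Prop :=
  IsCharacter χ ∧ χ 1 = 1

/-- The standard Hermitian product `⟨χ, φ⟩ = |G|⁻¹ ∑ g, χ g * conj (φ g)`. -/
noncomputable def charInner {G : Type*} [Group G] [Finite G] (χ φ : G → ℂ) : ℂ :=
  (Nat.card G : ℂ)⁻¹ * ∑ᶠ g : G, χ g * (starRingEnd ℂ) (φ g)

open Classical in
/-- The induced function `θ^G(g) = |H|⁻¹ ∑ x, θ⁰(x g x⁻¹)`, where `θ⁰` is `θ` extended by zero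
to `G`. -/
noncomputable def induced {G : Type*} [Group G] [Finite G] (H : Subgroup G) (θ : H → ℂ) :
    G → ℂ := fun g =>
  (Nat.card H : ℂ)⁻¹ *
    ∑ᶠ x : G, if h : x * g * x⁻¹ ∈ H then θ ⟨x * g * x⁻¹, h⟩ else 0

open scoped ComplexOrder in
/-- The set of (irreducible) constituents of `χ`. -/
def Cons {G : Type*} [Group G] [Finite G] (χ : G → ℂ) : Set (G → ℂ) :=
  {φ | φ ∈ Irr G ∧ 0 < charInner φ χ}

/-- The restriction to `N` of a function on the subgroup `H` containing `N`. -/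
def restrict {G : Type*} [Group G] {N H : Subgroup G} (hNH : N ≤ H) (ψ : H → ℂ) : N → ℂ :=
  fun x => ψ (Subgroup.inclusion hNH x)

/-- Almost monomial finite groups. -/
def IsAlmostMonomial (G : Type*) [Group G] [Finite G] : Prop :=
  ∀ χ ∈ Irr G, ∀ φ ∈ Irr G, χ ≠ φ →
    ∃ (H : Subgroup G) (lam : H → ℂ), IsLinearCharacter lam ∧
      χ ∈ Cons (induced H lam) ∧ φ ∉ Cons (induced H lam)

/-- Finite groups that are relative almost monomial with respect to a normal subgroup `N`. -/
def IsRelativeAlmostMonomial (G : Type*) [Group G] [Finite G] (N : Subgroup G) [N.Normal] :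
    Prop :=
  ∀ χ ∈ Irr G, ∀ φ ∈ Irr G, χ ≠ φ →
    ∃ (H : Subgroup G) (hNH : N ≤ H), ∃ ψ ∈ Irr H, restrict hNH ψ ∈ Irr N ∧
      χ ∈ Cons (induced H ψ) ∧ φ ∉ Cons (induced H ψ)

end AlmostMonomial

/-!
It is enough to show that the characters `ψ` in the definition of a relative almost monomial group
are monomial: if `ψ = λ^H` with `λ` a linear character of `K ≤ H`, then `ψ^G = λ^G` by transitivity
of induction (`exists_induced_eq_induced_induced`), so the pair `(K, λ)` separates the same
characters as `(H, ψ)`.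

So let `V` be a representation of a solvable group `T` that is irreducible over a normal subgroup
`S` whose `p`-subgroups are abelian. If `S` acts on `V` by scalars, then `dim V = 1`. Otherwise take
the last term `A` of the derived series of `S` that does not act by scalars. Commutators of `A` act
by scalars, so the image of `A` in `GL(V)` is nilpotent with abelian Sylow subgroups, hence abelian
(`commute_map_of_commute_commutator`). Thus `A` has a nonzero weight space `X` on `V`, and `X ≠ V`.
As `A` is normal in `T`, the group `T` permutes the weight spaces of `A`, which are independent.
Therefore the stabilizer `T₁` of `X` satisfies `[T : T₁] dim X ≤ dim V`, and `X` is again irreducible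
over `S ∩ T₁`. Induction on `V` gives a subgroup `H` of index at most `dim V` with a common
eigenvector `v` (`exists_eigenvector_relIndex_le_finrank`). The translates of `v` span `V`, so by the
bound on the index they form a basis, and taking the trace in it shows that the character of `V` is
induced from the linear character by which `H` acts on `v`
(`character_eq_induced_of_eigenvector`).

Working with the eigenvector and the index of `H`, instead of with induced characters, keeps the
whole induction inside the subgroups of one group and the subspaces of one space.
-/

namespace AlmostMonomial

open Module
open scoped commutatorElement

/-! ### Commutators and abelian Sylow subgroups -/

/-- If the commutators of `A` become central in the image of `f`, then that image is nilpotent, hence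
the product of its Sylow subgroups. These are images of Sylow subgroups of `A`, so the image is
abelian when the latter are. -/
theorem commute_map_of_commute_commutator {A Q : Type*} [Group A] [Finite A] [Group Q] (f : A →* Q)
    (hA : ∀ (p : ℕ) [Fact p.Prime] (P : Sylow p A), IsMulCommutative P)
    (hc : ∀ a b c : A, Commute (f ⁅a, b⁆) (f c)) (a b : A) : Commute (f a) (f b) := by
  have hsurj : Function.Surjective f.rangeRestrict := f.rangeRestrict_surjective
  have : Finite f.range := Finite.of_surjective _ hsurj
  have hnil : Group.IsNilpotent f.range := by
    refine Subgroup.isNilpotent_of_ker_le_center (Abelianization.of (G := f.range)) ?_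
    rw [Abelianization.ker_of, commutator_eq_closure, Subgroup.closure_le]
    rintro _ ⟨x, y, rfl⟩
    obtain ⟨a, rfl⟩ := hsurj x
    obtain ⟨b, rfl⟩ := hsurj y
    rw [SetLike.mem_coe, Subgroup.mem_center_iff]
    intro z
    obtain ⟨c, rfl⟩ := hsurj z
    rw [← map_commutatorElement]
    exact Subtype.ext (hc a b c).eq.symm
  -- Identify the image with the product of its Sylow subgroups and compare components.
  obtain ⟨e⟩ := (Group.isNilpotent_of_finite_tfae.out 0 4).mp hnil
  have key : ∀ x y : f.range, x * y = y * x := by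
    intro x y
    apply e.symm.injective
    rw [map_mul, map_mul]
    funext p P
    have : Fact (p : ℕ).Prime := ⟨Nat.prime_of_mem_primeFactors p.2⟩
    obtain ⟨R, rfl⟩ := Sylow.mapSurjective_surjective hsurj p P
    have := hA p R
    obtain ⟨⟨_, ⟨u, hu, rfl⟩⟩, hx⟩ : ∃ u, u = e.symm x p (R.mapSurjective hsurj) := ⟨_, rfl⟩
    obtain ⟨⟨_, ⟨v, hv, rfl⟩⟩, hy⟩ : ∃ u, u = e.symm y p (R.mapSurjective hsurj) := ⟨_, rfl⟩
    simp only [Pi.mul_apply]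
    rw [← hx, ← hy]
    refine Subtype.ext ?_
    have huv : u * v = v * u :=
      congrArg Subtype.val (this.is_comm.comm (⟨u, hu⟩ : R) ⟨v, hv⟩)
    change f.rangeRestrict u * f.rangeRestrict v = f.rangeRestrict v * f.rangeRestrict u
    rw [← map_mul, huv, map_mul]
  exact congrArg Subtype.val (key (f.rangeRestrict a) (f.rangeRestrict b))

/-- The last term of the derived series of `S` not contained in `{g | Q g}`. It is stated for an
arbitrary predicate `Q`; in the application, `Q g` says that `g` acts as a scalar. -/
theorem exists_le_not_and_commutator {G : Type*} [Group G] [Finite G]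
    [Group.IsSolvable G] (Q : G → Prop) (hQ : Q 1) (T S : Subgroup G)
    (hTS : ∀ t ∈ T, ∀ s ∈ S, t * s * t⁻¹ ∈ S) (hS : ∃ s ∈ S, ¬ Q s) :
    ∃ A ≤ S, (∀ t ∈ T, ∀ a ∈ A, t * a * t⁻¹ ∈ A) ∧ (∃ a ∈ A, ¬ Q a) ∧
      ∀ a ∈ A, ∀ b ∈ A, Q ⁅a, b⁆ := by
  induction S using WellFoundedLT.induction with
  | ind S ih =>
    by_cases h : ∀ a ∈ S, ∀ b ∈ S, Q ⁅a, b⁆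
    · exact ⟨S, le_rfl, hTS, hS, h⟩
    · push Not at h
      obtain ⟨a, ha, b, hb, hab⟩ := h
      have hne : S ≠ ⊥ := by
        rintro rfl
        obtain ⟨s, hs, hs'⟩ := hS
        rw [Subgroup.mem_bot.mp hs] at hs'
        exact hs' hQ
      have hlt : ⁅S, S⁆ < S := Group.IsSolvable.commutator_lt_of_ne_bot hne
      obtain ⟨A, hA, hA'⟩ := ih ⁅S, S⁆ hlt (fun t ht s hs ↦ by
        have hmap : S.map (MulAut.conj t).toMonoidHom ≤ S := by
          rintro _ ⟨s, hs, rfl⟩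
          exact hTS t ht s hs
        have := Subgroup.mem_map_of_mem (MulAut.conj t).toMonoidHom hs
        rw [Subgroup.map_commutator] at this
        exact Subgroup.commutator_mono hmap hmap this)
        ⟨_, Subgroup.commutator_mem_commutator ha hb, hab⟩
      exact ⟨A, hA.trans hlt.le, hA'⟩

/-! ### Weight spaces -/

section Weight

variable {G V : Type*} [Group G] [AddCommGroup V] [Module ℂ V]

/-- The space of vectors on which every `a ∈ A` acts as the scalar `χ a`. No multiplicativity
of `χ` is required: the space is zero unless `χ` is a linear character. -/
noncomputable def weightSpace (ρ : Representation ℂ G V) (A : Subgroup G) (χ : A → ℂ) :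
    Submodule ℂ V :=
  ⨅ a : A, End.eigenspace (ρ a) (χ a)

variable {ρ : Representation ℂ G V} {A : Subgroup G}

theorem mem_weightSpace {χ : A → ℂ} {v : V} :
    v ∈ weightSpace ρ A χ ↔ ∀ a : A, ρ a v = χ a • v := by
  simp [weightSpace]

/-- Weight spaces are independent, without any commutation between the operators `ρ a`. -/
theorem iSupIndep_weightSpace : iSupIndep (weightSpace ρ A) := by
  classical
  suffices ∀ (s : Finset (A → ℂ)) (χ : A → ℂ), χ ∉ s →
      Disjoint (weightSpace ρ A χ) (s.sup (weightSpace ρ A)) by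
    rw [iSupIndep_iff_supIndep]
    intro s
    rw [Finset.supIndep_iff_disjoint_erase]
    exact fun χ _ ↦ this _ _ (s.notMem_erase χ)
  intro s
  induction s using Finset.induction_on with
  | empty => simp
  | insert χ₂ s _ ih =>
    intro χ₁ hχ
    obtain ⟨hne, hχ₁⟩ : χ₁ ≠ χ₂ ∧ χ₁ ∉ s := by rwa [Finset.mem_insert, not_or] at hχ
    rw [Finset.sup_insert, Submodule.disjoint_def]
    intro x hx hx'
    obtain ⟨y, hy, z, hz, rfl⟩ := Submodule.mem_sup.mp hx'
    obtain ⟨a, ha⟩ := Function.ne_iff.mp hne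
    have hinv : ∀ z ∈ s.sup (weightSpace ρ A), ρ a z ∈ s.sup (weightSpace ρ A) := by
      intro z hz
      have : s.sup (weightSpace ρ A) ≤ (s.sup (weightSpace ρ A)).comap (ρ a) :=
        Finset.sup_le fun χ hs v hv ↦ by
          rw [Submodule.mem_comap, mem_weightSpace.mp hv a]
          exact Submodule.smul_mem _ _ (Finset.le_sup (f := weightSpace ρ A) hs hv)
      exact this hz
    -- Applying `ρ a - χ₂ a` removes `y` and multiplies the sum by a nonzero scalar.
    have h1 : (χ₁ a - χ₂ a) • (y + z) = ρ a z - χ₂ a • z := by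
      have h := mem_weightSpace.mp hx a
      rw [map_add, mem_weightSpace.mp hy a] at h
      rw [sub_smul, ← h, smul_add]
      abel
    have h2 := Submodule.disjoint_def.mp (ih χ₁ hχ₁) _ (Submodule.smul_mem _ (χ₁ a - χ₂ a) hx)
      (h1 ▸ Submodule.sub_mem _ (hinv z hz) (Submodule.smul_mem _ _ hz))
    exact (smul_eq_zero.mp h2).resolve_left (sub_ne_zero.mpr ha)

/-- Commuting operators have a common eigenvector: if some `a ∈ A` has a proper eigenspace in `W`,
pass to that eigenspace, which is again `A`-invariant. -/
theorem exists_weightSpace_ne_bot [FiniteDimensional ℂ V] {W : Submodule ℂ V} (hW : W ≠ ⊥)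
    (hAW : ∀ a ∈ A, ∀ w ∈ W, ρ a w ∈ W)
    (hcomm : ∀ a ∈ A, ∀ b ∈ A, ∀ w ∈ W, ρ a (ρ b w) = ρ b (ρ a w)) :
    ∃ χ : A → ℂ, W ⊓ weightSpace ρ A χ ≠ ⊥ := by
  induction W using WellFoundedLT.induction with
  | ind W ih =>
    have : Nontrivial W := Submodule.nontrivial_iff_ne_bot.mpr hW
    have heig (a : A) : ∃ c : ℂ, W ⊓ End.eigenspace (ρ a) c ≠ ⊥ := by
      obtain ⟨c, hc⟩ := End.exists_eigenvalue ((ρ a).restrict (hAW a a.2))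
      obtain ⟨w, hw⟩ := hc.exists_hasEigenvector
      refine ⟨c, (Submodule.ne_bot_iff _).mpr ⟨w, ⟨w.2, ?_⟩, by simpa using hw.2⟩⟩
      exact End.mem_eigenspace_iff.mpr (congrArg Subtype.val hw.apply_eq_smul)
    choose χ hχ using heig
    by_cases h : ∀ a : A, W ⊓ End.eigenspace (ρ a) (χ a) = W
    · refine ⟨χ, ?_⟩
      rwa [weightSpace, inf_eq_left.mpr (le_iInf fun a ↦ inf_eq_left.mp (h a))]
    · push Not at h
      obtain ⟨a, ha⟩ := h
      obtain ⟨χ', hχ'⟩ := ih _ (lt_of_le_of_ne inf_le_left ha) (hχ a)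
        (fun b hb w hw ↦ ⟨hAW b hb w hw.1, by
          rw [SetLike.mem_coe, End.mem_eigenspace_iff, hcomm a a.2 b hb w hw.1,
            End.mem_eigenspace_iff.mp hw.2, map_smul]⟩)
        (fun b hb c hc w hw ↦ hcomm b hb c hc w hw.1)
      exact ⟨χ', fun h0 ↦ hχ' (le_bot_iff.mp (h0 ▸ inf_le_inf_right _ inf_le_left))⟩

/-- An element normalizing `A` permutes the weight spaces of `A`. -/
theorem exists_map_weightSpace_eq {W : Submodule ℂ V} (t : G)
    (htA : ∀ a ∈ A, t * a * t⁻¹ ∈ A) (htA' : ∀ a ∈ A, t⁻¹ * a * t ∈ A)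
    (htW : W.map (ρ t) = W) (χ : A → ℂ) :
    ∃ χ' : A → ℂ, (W ⊓ weightSpace ρ A χ).map (ρ t) = W ⊓ weightSpace ρ A χ' := by
  refine ⟨fun a ↦ χ ⟨t⁻¹ * a * t, htA' a a.2⟩, ?_⟩
  have hinj : Function.Injective (ρ t) := (ρ.apply_bijective t).1
  rw [Submodule.map_inf _ hinj, htW]
  congr 1
  ext v
  rw [mem_weightSpace, Submodule.mem_map]
  constructor
  · rintro ⟨w, hw, rfl⟩ a
    have := mem_weightSpace.mp hw ⟨t⁻¹ * a * t, htA' a a.2⟩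
    rw [← map_smul, ← this, ← Module.End.mul_apply, ← Module.End.mul_apply, ← map_mul, ← map_mul]
    congr 2
    group
  · intro h
    refine ⟨ρ t⁻¹ v, mem_weightSpace.mpr fun a ↦ ?_, by simp⟩
    have h1 := h ⟨t * a * t⁻¹, htA a a.2⟩
    have h2 : (⟨t⁻¹ * (t * a * t⁻¹) * t, htA' _ (htA a a.2)⟩ : A) = a :=
      Subtype.ext (by group)
    rw [h2] at h1
    rw [← map_smul, ← h1, ← Module.End.mul_apply, ← Module.End.mul_apply, ← map_mul, ← map_mul]
    congr 2
    group

/-- Independent subspaces of `W` of the same dimension `d`: their number times `d` is at most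
`dim W`. -/
theorem card_mul_finrank_le [FiniteDimensional ℂ V] {ι : Type*} [Fintype ι]
    {p : ι → Submodule ℂ V} (hp : iSupIndep p) {W : Submodule ℂ V} (hW : ∀ i, p i ≤ W) {d : ℕ}
    (hd : ∀ i, finrank ℂ (p i) = d) : Fintype.card ι * d ≤ finrank ℂ W := by
  classical
  have h1 := LinearMap.finrank_range_of_inj hp.dfinsupp_lsum_injective
  rw [← Submodule.iSup_eq_range_dfinsupp_lsum] at h1
  have h2 : finrank ℂ (Π₀ i, p i) = ∑ i, finrank ℂ (p i) := Module.finrank_directSum ℂ fun i ↦ p i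
  have h3 := Submodule.finrank_mono (iSup_le hW)
  simp only [h1, h2, hd, Finset.sum_const, Finset.card_univ, smul_eq_mul] at h3
  exact h3

end Weight

/-! ### Imprimitivity -/

section Imprimitive

variable {G V : Type*} [Group G] [AddCommGroup V] [Module ℂ V]

/-- The subgroup of all group elements mapping the subspace `X` onto itself. -/
def subspaceStabilizer (ρ : Representation ℂ G V) (X : Submodule ℂ V) : Subgroup G where
  carrier := {g | X.map (ρ g) = X}
  one_mem' := by
    rw [Set.mem_ofPred_eq, map_one]
    exact Submodule.map_id X
  mul_mem' {a b} ha hb := by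
    rw [Set.mem_ofPred_eq] at *
    rw [map_mul, Module.End.mul_eq_comp, Submodule.map_comp, hb, ha]
  inv_mem' {a} ha := by
    rw [Set.mem_ofPred_eq] at *
    conv_lhs => rw [← ha]
    rw [← Submodule.map_comp, ← Module.End.mul_eq_comp, ← map_mul, inv_mul_cancel, map_one]
    exact Submodule.map_id X

theorem mem_subspaceStabilizer {ρ : Representation ℂ G V} {X : Submodule ℂ V} {g : G} :
    g ∈ subspaceStabilizer ρ X ↔ X.map (ρ g) = X := Iff.rfl

theorem commute_of_scalar_commutator [Finite G] {ρ : Representation ℂ G V} {A : Subgroup G}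
    {W : Submodule ℂ V} (hAW : ∀ a ∈ A, ∀ w ∈ W, ρ a w ∈ W)
    (hA : ∀ (p : ℕ) [Fact p.Prime] (P : Subgroup G), P ≤ A → IsPGroup p P →
      ∀ x ∈ P, ∀ y ∈ P, x * y = y * x)
    (hscal : ∀ a ∈ A, ∀ b ∈ A, ∃ c : ℂ, ∀ w ∈ W, ρ ⁅a, b⁆ w = c • w) :
    ∀ a ∈ A, ∀ b ∈ A, ∀ w ∈ W, ρ a (ρ b w) = ρ b (ρ a w) := by
  let r : A →* End ℂ W :=
    { toFun a := (ρ a).restrict (hAW a a.2)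
      map_one' := by ext; simp
      map_mul' a b := by ext; simp }
  have hr (a : A) (w : W) : (r a w : V) = ρ a w := rfl
  intro a ha b hb w hw
  have hcomm : Commute (r.toHomUnits ⟨a, ha⟩) (r.toHomUnits ⟨b, hb⟩) := by
    refine commute_map_of_commute_commutator r.toHomUnits ?_ ?_ _ _
    · intro p _ P
      refine ⟨⟨fun x y ↦ Subtype.ext (Subtype.ext ?_)⟩⟩
      exact hA p (P.map A.subtype) (Subgroup.map_subtype_le _) (P.2.map _) x
        (Subgroup.mem_map_of_mem A.subtype x.2) y (Subgroup.mem_map_of_mem A.subtype y.2)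
    · intro a b c
      obtain ⟨z, hz⟩ := hscal a a.2 b b.2
      refine Units.ext (LinearMap.ext fun w ↦ Subtype.ext ?_)
      change ρ ⁅(a : G), b⁆ (ρ c w) = ρ c (ρ ⁅(a : G), b⁆ w)
      rw [hz _ (hAW c c.2 w w.2), hz w w.2, map_smul]
  have h := congrArg (fun u : (End ℂ W)ˣ ↦ ((u : End ℂ W) ⟨w, hw⟩ : V)) hcomm.eq
  exact h

variable [FiniteDimensional ℂ V]

theorem map_eq_of_forall_mem {ρ : Representation ℂ G V} {W : Submodule ℂ V} {g : G}
    (h : ∀ w ∈ W, ρ g w ∈ W) : W.map (ρ g) = W := by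
  refine Submodule.eq_of_le_of_finrank_eq (Submodule.map_le_iff_le_comap.mpr h) ?_
  exact (Submodule.equivMapOfInjective _ (ρ.apply_bijective g).1 W).finrank_eq.symm

/-- A representation `W` of `T` that stays irreducible over a normal subgroup `S` with abelian
`p`-subgroups contains an eigenvector of a subgroup of `T` of index at most `dim W`. Everything is
phrased in the ambient group `G` and the ambient space `V`, with `hirr` expressing irreducibility of
`W` over `S`. -/
theorem exists_eigenvector_relIndex_le_finrank [Finite G] [Group.IsSolvable G]
    (ρ : Representation ℂ G V) (T S : Subgroup G) (W : Submodule ℂ V) (hW : W ≠ ⊥) (hST : S ≤ T)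
    (hTS : ∀ t ∈ T, ∀ s ∈ S, t * s * t⁻¹ ∈ S) (hTW : ∀ t ∈ T, ∀ w ∈ W, ρ t w ∈ W)
    (hS : ∀ (p : ℕ) [Fact p.Prime] (P : Subgroup G), P ≤ S → IsPGroup p P →
      ∀ x ∈ P, ∀ y ∈ P, x * y = y * x)
    (hirr : ∀ X ≤ W, (∀ s ∈ S, ∀ x ∈ X, ρ s x ∈ X) → X ≠ ⊥ → X = W) :
    ∃ H ≤ T, ∃ v : V, v ≠ 0 ∧ (∀ h ∈ H, ∃ c : ℂ, ρ h v = c • v) ∧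
      H.relIndex T ≤ finrank ℂ W := by
  classical
  induction W using WellFoundedLT.induction generalizing T S with
  | ind W ih =>
  obtain ⟨v, hvW, hv0⟩ := (Submodule.ne_bot_iff W).mp hW
  by_cases h1 : finrank ℂ W = 1
  · refine ⟨T, le_rfl, v, hv0, fun t ht ↦ ?_, by simp [h1]⟩
    obtain ⟨c, hc⟩ := (finrank_eq_one_iff_of_nonzero' (⟨v, hvW⟩ : W)
      (by simpa using hv0)).mp h1 ⟨ρ t v, hTW t ht v hvW⟩
    exact ⟨c, (congrArg Subtype.val hc).symm⟩
  -- If all of `S` acted by scalars, the line spanned by `v` would be all of `W`.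
  have hnonscalar : ∃ s ∈ S, ¬ ∃ c : ℂ, ∀ w ∈ W, ρ s w = c • w := by
    by_contra! h
    refine h1 ?_
    rw [← hirr (ℂ ∙ v) ((Submodule.span_singleton_le_iff_mem _ _).mpr hvW) ?_ (by simpa using hv0),
      finrank_span_singleton hv0]
    intro s hs x hx
    obtain ⟨c, hc⟩ := h s hs
    rw [hc x ((Submodule.span_singleton_le_iff_mem _ _).mpr hvW hx)]
    exact Submodule.smul_mem _ _ hx
  obtain ⟨A, hAS, hTA, ⟨a₀, ha₀, hna₀⟩, hAcomm⟩ := exists_le_not_and_commutator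
    (fun g ↦ ∃ c : ℂ, ∀ w ∈ W, ρ g w = c • w) ⟨1, by simp⟩ T S hTS hnonscalar
  have hAT : A ≤ T := hAS.trans hST
  obtain ⟨χ, hχ⟩ := exists_weightSpace_ne_bot hW (fun a ha ↦ hTW a (hAT ha))
    (commute_of_scalar_commutator (fun a ha ↦ hTW a (hAT ha))
      (fun p _ P hP ↦ hS p P (hP.trans hAS)) hAcomm)
  have hperm (t : G) (ht : t ∈ T) : ∃ χ' : A → ℂ,
      (W ⊓ weightSpace ρ A χ).map (ρ t) = W ⊓ weightSpace ρ A χ' :=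
    exists_map_weightSpace_eq t (hTA t ht)
      (fun a ha ↦ by simpa using hTA t⁻¹ (T.inv_mem ht) a ha)
      (map_eq_of_forall_mem (hTW t ht)) χ
  set X := W ⊓ weightSpace ρ A χ with hX
  have hXlt : X < W := by
    refine lt_of_le_of_ne inf_le_left fun h ↦ hna₀ ⟨χ ⟨a₀, ha₀⟩, fun w hw ↦ ?_⟩
    rw [← h] at hw
    exact mem_weightSpace.mp hw.2 ⟨a₀, ha₀⟩
  have hstab {t : G} (ht : t ∈ subspaceStabilizer ρ X) {x : V} (hx : x ∈ X) : ρ t x ∈ X := by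
    rw [← mem_subspaceStabilizer.mp ht]
    exact Submodule.mem_map_of_mem hx
  obtain ⟨H, hHT, u, hu0, hu, hidx⟩ := ih X hXlt (T ⊓ subspaceStabilizer ρ X)
    (S ⊓ subspaceStabilizer ρ X) hχ (inf_le_inf_right _ hST)
    (fun t ht s hs ↦ ⟨hTS t ht.1 s hs.1,
      Subgroup.mul_mem _ (Subgroup.mul_mem _ ht.2 hs.2) (Subgroup.inv_mem _ ht.2)⟩)
    (fun t ht x hx ↦ hstab ht.2 hx) (fun p _ P hP ↦ hS p P (hP.trans inf_le_left)) (by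
      intro X' hX' hinv hne
      refine le_antisymm hX' ?_
      have hYW : ⨆ s : S, X'.map (ρ s) = W := by
        refine hirr _ (iSup_le fun s ↦ ?_) ?_ ?_
        · rintro _ ⟨x, hx, rfl⟩
          exact hTW s (hST s.2) x (hX' hx).1
        · intro s hs x hx
          have : ⨆ s : S, X'.map (ρ s) ≤ (⨆ s : S, X'.map (ρ s)).comap (ρ s) := by
            refine iSup_le fun s' ↦ ?_
            rintro _ ⟨x, hx, rfl⟩
            refine Submodule.mem_iSup_of_mem (⟨s, hs⟩ * s' : S) ⟨x, hx, ?_⟩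
            simp
          exact this hx
        · refine fun h ↦ hne (le_bot_iff.mp (h ▸ fun x hx ↦ ?_))
          exact Submodule.mem_iSup_of_mem (1 : S) ⟨x, hx, by simp⟩
      -- The `S`-translates of `X'` span `W`; those by elements of the stabilizer stay in `X'`, and
      -- the others lie in weight spaces other than that of `χ`.
      have hle : W ≤ X' ⊔ ⨆ (χ') (_ : χ' ≠ χ), weightSpace ρ A χ' := by
        rw [← hYW]
        refine iSup_le fun s ↦ ?_
        by_cases hs : (s : G) ∈ subspaceStabilizer ρ X
        · refine le_trans ?_ le_sup_left
          rintro _ ⟨x, hx, rfl⟩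
          exact hinv s ⟨s.2, hs⟩ x hx
        · refine le_trans ?_ le_sup_right
          obtain ⟨χ', hχ'⟩ := hperm s (hST s.2)
          have hχne : χ' ≠ χ := by
            rintro rfl
            exact hs hχ'
          refine le_trans ?_ (le_iSup₂_of_le χ' hχne le_rfl)
          exact (Submodule.map_mono hX').trans (hχ'.le.trans inf_le_right)
      intro x hx
      obtain ⟨y, hy, d, hd, rfl⟩ := Submodule.mem_sup.mp (hle hx.1)
      have hd' : d ∈ weightSpace ρ A χ := by
        have := Submodule.sub_mem _ hx.2 (hX' hy).2
        rwa [add_sub_cancel_left] at this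
      rw [Submodule.disjoint_def.mp (iSupIndep_weightSpace χ) d hd' hd, add_zero]
      exact hy)
  refine ⟨H, hHT.trans inf_le_left, u, hu0, hu, ?_⟩
  set T₁ := T ⊓ subspaceStabilizer ρ X with hT₁
  -- The translates of `X` under `T` are indexed by the cosets of `T₁` and are independent.
  have hcount : T₁.relIndex T * finrank ℂ X ≤ finrank ℂ W := by
    have := Fintype.ofFinite (T ⧸ T₁.subgroupOf T)
    rw [Subgroup.relIndex, Subgroup.index, Nat.card_eq_fintype_card]
    choose χ' hχ' using fun q : T ⧸ T₁.subgroupOf T ↦ hperm (q.out : G) q.out.2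
    refine card_mul_finrank_le (p := fun q : T ⧸ T₁.subgroupOf T ↦ X.map (ρ (q.out : G)))
      ((iSupIndep_weightSpace.comp (f := χ') ?_).mono fun q ↦ (hχ' q).le.trans inf_le_right)
      (fun q ↦ (hχ' q).le.trans inf_le_left) fun q ↦
        (Submodule.equivMapOfInjective _ (ρ.apply_bijective _).1 X).finrank_eq.symm
    intro q q' hqq
    have h : X.map (ρ (q.out : G)) = X.map (ρ (q'.out : G)) := by rw [hχ', hχ', hqq]
    rw [← q.out_eq', ← q'.out_eq', QuotientGroup.eq, Subgroup.mem_subgroupOf]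
    refine ⟨(q.out⁻¹ * q'.out).2, mem_subspaceStabilizer.mpr ?_⟩
    rw [Subgroup.coe_mul, Subgroup.coe_inv, map_mul, Module.End.mul_eq_comp, Submodule.map_comp, ← h, ← Submodule.map_comp,
      ← Module.End.mul_eq_comp, ← map_mul, inv_mul_cancel, map_one]
    exact Submodule.map_id X
  calc H.relIndex T = H.relIndex T₁ * T₁.relIndex T :=
        (Subgroup.relIndex_mul_relIndex _ _ _ hHT inf_le_left).symm
    _ ≤ finrank ℂ X * T₁.relIndex T := Nat.mul_le_mul_right _ hidx
    _ ≤ finrank ℂ W := by rwa [mul_comm]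

end Imprimitive

/-! ### Induced characters -/

section Induced

variable {G : Type*} [Group G] [Finite G]

/-- An irreducible representation with an eigenvector for a subgroup `H` of index at most its
dimension is induced from a linear character of `H`. -/
theorem character_eq_induced_of_eigenvector {V : Type*} [AddCommGroup V] [Module ℂ V]
    [FiniteDimensional ℂ V] (ρ : Representation ℂ G V)
    (hirr : ∀ X : Submodule ℂ V, (∀ g, ∀ x ∈ X, ρ g x ∈ X) → X ≠ ⊥ → X = ⊤)
    (H : Subgroup G) (v : V) (hv : v ≠ 0) (hH : ∀ h ∈ H, ∃ c : ℂ, ρ h v = c • v)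
    (hidx : H.index ≤ finrank ℂ V) :
    ∃ lam : H → ℂ, IsLinearCharacter lam ∧ ρ.character = induced H lam := by
  classical
  have := Fintype.ofFinite G
  choose lam hlam using fun h : H ↦ hH h h.2
  have hone : lam 1 = 1 := smul_left_injective ℂ hv (by simp [← hlam])
  have hmul (a b : H) : lam (a * b) = lam a * lam b := by
    refine smul_left_injective ℂ hv ?_
    change lam (a * b) • v = (lam a * lam b) • v
    rw [← hlam, Subgroup.coe_mul, map_mul, Module.End.mul_apply, hlam b, map_smul, hlam a,
      smul_smul, mul_comm]
  let ρ₁ : Representation ℂ H (Fin 1 → ℂ) :=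
    { toFun h := lam h • 1
      map_one' := by rw [hone, one_smul]
      map_mul' a b := by rw [hmul, smul_mul_smul_comm, one_mul] }
  refine ⟨lam, ⟨⟨1, ρ₁, one_pos, ?_⟩, hone⟩, ?_⟩
  · ext h
    change LinearMap.trace ℂ _ (lam h • (1 : End ℂ (Fin 1 → ℂ))) = lam h
    rw [map_smul, LinearMap.trace_one]
    simp
  -- The vectors `ρ q.out v`, for `q` a coset of `H`, form a basis permuted up to scalars by `G`.
  let b : G ⧸ H → V := fun q ↦ ρ q.out v
  have hb (g : G) (q : G ⧸ H) : ∃ h : H, g * q.out = (↑(g * q.out) : G ⧸ H).out * h ∧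
      ρ g (b q) = lam h • b ↑(g * q.out) := by
    obtain ⟨h, hh⟩ := QuotientGroup.mk_out_eq_mul H (g * q.out)
    have h1 : g * q.out = (↑(g * q.out) : G ⧸ H).out * (h⁻¹ : H) := by rw [hh]; simp
    refine ⟨h⁻¹, h1, ?_⟩
    change ρ g (ρ q.out v) = lam h⁻¹ • ρ _ v
    rw [← Module.End.mul_apply, ← map_mul]
    conv_lhs => rw [h1]
    rw [map_mul, Module.End.mul_apply, hlam, map_smul]
  have hspan : Submodule.span ℂ (Set.range b) = ⊤ := by
    refine hirr _ (fun g x hx ↦ ?_) ?_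
    · have : Submodule.span ℂ (Set.range b) ≤ (Submodule.span ℂ (Set.range b)).comap (ρ g) := by
        rw [Submodule.span_le]
        rintro _ ⟨q, rfl⟩
        obtain ⟨h, -, hh⟩ := hb g q
        rw [SetLike.mem_coe, Submodule.mem_comap, hh]
        exact Submodule.smul_mem _ _ (Submodule.subset_span ⟨_, rfl⟩)
      exact this hx
    · refine (Submodule.ne_bot_iff _).mpr ⟨b ↑(1 : G), Submodule.subset_span ⟨_, rfl⟩, ?_⟩
      exact (map_ne_zero_iff _ (ρ.apply_bijective _).1).mpr hv
  have hcard : Fintype.card (G ⧸ H) = finrank ℂ V := by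
    refine le_antisymm ?_ ?_
    · rwa [← Nat.card_eq_fintype_card]
    · rw [← finrank_top ℂ V, ← hspan]
      exact finrank_range_le_card b
  let B := Basis.mk (linearIndependent_of_top_le_span_of_card_eq_finrank hspan.ge hcard) hspan.ge
  have hB (q : G ⧸ H) : B q = b q := Basis.mk_apply _ _ _
  ext g
  let F : G → ℂ := fun x ↦ if h : x⁻¹ * g * x ∈ H then lam ⟨x⁻¹ * g * x, h⟩ else 0
  -- The summand of the induction formula, with `x` replaced by `x⁻¹`, depends only on `x H`.
  have hF (x : G) (k : H) : F (x * k) = F x := by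
    have hconj : (x * k)⁻¹ * g * (x * k) = (k : G)⁻¹ * (x⁻¹ * g * x) * k := by group
    have hiff : (x * k)⁻¹ * g * (x * k) ∈ H ↔ x⁻¹ * g * x ∈ H := by
      rw [hconj, H.mul_mem_cancel_right k.2, H.mul_mem_cancel_left (H.inv_mem k.2)]
    by_cases h : x⁻¹ * g * x ∈ H
    · have h' := hiff.mpr h
      simp only [F, dif_pos h, dif_pos h']
      have : (⟨_, h'⟩ : H) = k⁻¹ * ⟨_, h⟩ * k := Subtype.ext hconj
      rw [this, hmul, hmul, mul_right_comm, ← hmul, inv_mul_cancel, hone, one_mul]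
    · simp only [F, dif_neg h, dif_neg (mt hiff.mp h)]
  have htrace : ρ.character g = ∑ q : G ⧸ H, F q.out := by
    change LinearMap.trace ℂ V (ρ g) = _
    rw [LinearMap.trace_eq_matrix_trace ℂ B, Matrix.trace]
    refine Finset.sum_congr rfl fun q _ ↦ ?_
    obtain ⟨h, hh, hρ⟩ := hb g q
    rw [Matrix.diag_apply, LinearMap.toMatrix_apply, hB, hρ, ← hB, map_smul, B.repr_self,
      Finsupp.smul_apply, Finsupp.single_apply, smul_eq_mul]
    by_cases hq : (↑(g * q.out) : G ⧸ H) = q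
    · rw [if_pos hq, mul_one]
      rw [hq] at hh
      have : q.out⁻¹ * g * q.out = h := by rw [mul_assoc, hh]; simp
      simp only [F]
      rw [dif_pos (this ▸ h.2)]
      exact congrArg lam (Subtype.ext this.symm)
    · rw [if_neg hq, mul_zero]
      simp only [F]
      rw [dif_neg]
      refine fun hmem ↦ hq ?_
      conv_rhs => rw [← q.out_eq']
      refine (QuotientGroup.eq.mpr ?_).symm
      rwa [← mul_assoc]
  have hbij : Function.Bijective fun y : (G ⧸ H) × H ↦ y.1.out * (y.2 : G) := by
    constructor
    · rintro ⟨q, h⟩ ⟨q', h'⟩ hy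
      have hqq : q = q' := by
        have := congrArg (QuotientGroup.mk : G → G ⧸ H) hy
        simpa using this
      subst hqq
      simpa using hy
    · intro x
      obtain ⟨h, hh⟩ := QuotientGroup.mk_out_eq_mul H x
      exact ⟨(↑x, h⁻¹), by simp [hh]⟩
  have hsum : ∑ x : G, F x = Nat.card H * ∑ q : G ⧸ H, F q.out := by
    rw [← (Equiv.ofBijective _ hbij).sum_comp, Fintype.sum_prod_type, Finset.mul_sum]
    refine Finset.sum_congr rfl fun q _ ↦ ?_
    simp [hF]
  rw [induced, finsum_eq_sum_of_fintype, htrace, eq_inv_mul_iff_mul_eq₀ (by simp), ← hsum,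
    ← Equiv.sum_comp (Equiv.inv G)]
  refine Finset.sum_congr rfl fun x _ ↦ ?_
  simp [F]

/-- Transitivity of induction, for a linear character of a subgroup `K` of the subgroup `H`. -/
theorem exists_induced_eq_induced_induced (H : Subgroup G) (K : Subgroup H) {lam : K → ℂ}
    (hlam : IsLinearCharacter lam) :
    ∃ (L : Subgroup G) (mu : L → ℂ), IsLinearCharacter mu ∧
      induced L mu = induced H (induced K lam) := by
  classical
  have := Fintype.ofFinite G
  let e := K.equivMapOfInjective H.subtype H.subtype_injective
  refine ⟨K.map H.subtype, fun k ↦ lam (e.symm k), ?_, ?_⟩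
  · obtain ⟨⟨n, ρ, hn, hρ⟩, h1⟩ := hlam
    refine ⟨⟨n, ρ.comp e.symm.toMonoidHom, hn, ?_⟩, by simpa using h1⟩
    rw [← hρ]
    rfl
  ext g
  let F : G → ℂ := fun x ↦ if h : x ∈ K.map H.subtype then lam (e.symm ⟨x, h⟩) else 0
  -- `F` extends `lam` by zero, both from `K` to `H` and from `K` to `G`.
  have hF (x : H) : F x = if h : x ∈ K then lam ⟨x, h⟩ else 0 := by
    by_cases h : x ∈ K
    · have h' : (x : G) ∈ K.map H.subtype := Subgroup.mem_map_of_mem H.subtype h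
      simp only [F, dif_pos h, dif_pos h']
      congr 1
      rw [MulEquiv.symm_apply_eq]
      rfl
    · have h' : (x : G) ∉ K.map H.subtype := by simpa using h
      simp only [F, dif_neg h, dif_neg h']
  have hinner (x : G) : (if h : x * g * x⁻¹ ∈ H then induced K lam ⟨x * g * x⁻¹, h⟩ else 0) =
      (Nat.card K : ℂ)⁻¹ * ∑ y : H, F (y * x * g * (y * x)⁻¹) := by
    have hconj (y : H) : (y : G) * x * g * (y * x)⁻¹ = y * (x * g * x⁻¹) * (y : G)⁻¹ := by group
    by_cases h : x * g * x⁻¹ ∈ H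
    · rw [dif_pos h, induced, finsum_eq_sum_of_fintype]
      congr 1
      refine Finset.sum_congr rfl fun y _ ↦ ?_
      rw [hconj]
      exact (hF (y * ⟨_, h⟩ * y⁻¹)).symm
    · rw [dif_neg h, Finset.sum_eq_zero, mul_zero]
      intro y _
      refine dif_neg fun hmem ↦ h ?_
      have := Subgroup.map_subtype_le K hmem
      rwa [hconj, H.mul_mem_cancel_right (H.inv_mem y.2), H.mul_mem_cancel_left y.2] at this
  have hcardK : Nat.card (K.map H.subtype) = Nat.card K := (Nat.card_congr e.toEquiv).symm
  have hcardH : (Nat.card H : ℂ) ≠ 0 := by simp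
  rw [induced, induced, hcardK, finsum_eq_sum_of_fintype, finsum_eq_sum_of_fintype]
  simp_rw [hinner]
  rw [← Finset.mul_sum, Finset.sum_comm]
  have hshift (y : H) : ∑ x : G, F (y * x * g * (y * x)⁻¹) = ∑ x : G, F (x * g * x⁻¹) :=
    Equiv.sum_comp (Equiv.mulLeft (y : G)) fun x ↦ F (x * g * x⁻¹)
  simp_rw [hshift]
  rw [Finset.sum_const, Finset.card_univ, ← Nat.card_eq_fintype_card, nsmul_eq_mul,
    mul_left_comm, inv_mul_cancel_left₀ hcardH]

end Induced

/-- A representation with an irreducible character is irreducible. -/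
theorem eq_top_of_character_eq {N V W : Type*} [Group N] [Finite N] [AddCommGroup V]
    [Module ℂ V] [FiniteDimensional ℂ V] [AddCommGroup W] [Module ℂ W] [FiniteDimensional ℂ W]
    (σ : Representation ℂ N W) [σ.IsIrreducible] (τ : Representation ℂ N V)
    (h : τ.character = σ.character) (X : Submodule ℂ V) (hX : ∀ n, ∀ x ∈ X, τ n x ∈ X)
    (hX0 : X ≠ ⊥) : X = ⊤ := by
  have := Fintype.ofFinite N
  have : Invertible (Nat.card N : ℂ) := invertibleOfNonzero (by simp)
  have hrank : finrank ℂ (Representation.IntertwiningMap σ τ) = 1 := by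
    have h1 := Representation.card_inv_mul_sum_char_mul_char_eq_finrank σ τ
    rw [h, Representation.card_inv_mul_sum_char_mul_char_eq_finrank,
      Representation.IsIrreducible.finrank_intertwiningMap_self] at h1
    exact_mod_cast h1.symm
  have : Nontrivial (Representation.IntertwiningMap σ τ) :=
    Module.nontrivial_of_finrank_pos (R := ℂ) (by omega)
  -- A nonzero intertwiner is injective, and bijective because the degrees agree.
  obtain ⟨f, hf⟩ := exists_ne (0 : Representation.IntertwiningMap σ τ)
  have hinj : Function.Injective f.toLinearMap :=
    (Representation.IsIrreducible.injective_or_eq_zero f).resolve_right hf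
  have hdim : finrank ℂ W = finrank ℂ V := by
    have := congrFun h 1
    rw [Representation.char_one, Representation.char_one] at this
    exact_mod_cast this.symm
  have hsurj : Function.Surjective f.toLinearMap :=
    (LinearMap.injective_iff_surjective_of_finrank_eq_finrank hdim).mp hinj
  let Y : Subrepresentation σ :=
    { toSubmodule := X.comap f.toLinearMap
      apply_mem_toSubmodule := fun n w hw ↦ by
        rw [Submodule.mem_comap] at hw ⊢
        have := f.isIntertwining _ _ n w
        rw [Representation.IntertwiningMap.toLinearMap_apply, this]
        exact hX n _ hw }
  have hmap : X = (X.comap f.toLinearMap).map f.toLinearMap :=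
    (Submodule.map_comap_eq_of_surjective hsurj X).symm
  rcases eq_bot_or_eq_top Y with hY | hY
  · have : X.comap f.toLinearMap = ⊥ := congrArg Subrepresentation.toSubmodule hY
    rw [this, Submodule.map_bot] at hmap
    exact absurd hmap hX0
  · have : X.comap f.toLinearMap = ⊤ := congrArg Subrepresentation.toSubmodule hY
    rw [this, Submodule.map_top, LinearMap.range_eq_top.mpr hsurj] at hmap
    exact hmap

theorem mul_comm_of_isPGroup {G : Type*} [Group G] {N : Subgroup G}
    (hN : ∀ (p : ℕ) [Fact p.Prime] (P : Sylow p N), IsMulCommutative P) (p : ℕ) [Fact p.Prime]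
    {P : Subgroup G} (hPN : P ≤ N) (hP : IsPGroup p P) {x y : G} (hx : x ∈ P) (hy : y ∈ P) :
    x * y = y * x := by
  obtain ⟨Q, hQ⟩ := IsPGroup.exists_le_sylow (P := P.subgroupOf N) (p := p)
    (hP.of_equiv (Subgroup.subgroupOfEquivOfLe hPN).symm)
  have := hN p Q
  have h := this.is_comm.comm (⟨⟨x, hPN hx⟩, hQ hx⟩ : Q) ⟨⟨y, hPN hy⟩, hQ hy⟩
  exact congrArg (fun z : Q ↦ ((z : N) : G)) h

/-- A character of `H` whose restriction to `N` is irreducible is monomial. -/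
theorem exists_eq_induced_linear {G : Type*} [Group G] [Finite G] [Group.IsSolvable G]
    {N H : Subgroup G} [N.Normal]
    (hN : ∀ (p : ℕ) [Fact p.Prime] (P : Sylow p N), IsMulCommutative P) (hNH : N ≤ H)
    {ψ : H → ℂ} (hψ : ψ ∈ Irr H) (hψN : restrict hNH ψ ∈ Irr N) :
    ∃ (K : Subgroup H) (lam : K → ℂ), IsLinearCharacter lam ∧ ψ = induced K lam := by
  obtain ⟨n, ρ, hρ, rfl⟩ := hψ
  obtain ⟨m, σ, hσ, hσχ⟩ := hψN
  have hirr : ∀ X : Submodule ℂ (Fin n → ℂ), (∀ s ∈ N.subgroupOf H, ∀ x ∈ X, ρ s x ∈ X) →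
      X ≠ ⊥ → X = ⊤ := fun X hX ↦
    eq_top_of_character_eq σ (ρ.comp (Subgroup.inclusion hNH)) hσχ.symm X
      fun s x hx ↦ hX (Subgroup.inclusion hNH s) s.2 x hx
  have htop : (⊤ : Submodule ℂ (Fin n → ℂ)) ≠ ⊥ := fun h ↦
    (bot_ne_top (α := Subrepresentation ρ))
      (Subrepresentation.toSubmodule_injective h.symm)
  obtain ⟨K, -, v, hv, hK, hidx⟩ := exists_eigenvector_relIndex_le_finrank ρ ⊤ (N.subgroupOf H) ⊤
    htop le_top (fun t _ s hs ↦ Subgroup.Normal.conj_mem inferInstance s hs t) (by simp)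
    (fun p _ P hPN hP x hx y hy ↦ Subtype.ext (mul_comm_of_isPGroup hN p
      (P := P.map H.subtype) (by rintro _ ⟨z, hz, rfl⟩; exact hPN hz) (hP.map _)
      (Subgroup.mem_map_of_mem H.subtype hx) (Subgroup.mem_map_of_mem H.subtype hy)))
    (fun X _ ↦ hirr X)
  rw [Subgroup.relIndex_top_right, finrank_top] at hidx
  exact ⟨K, character_eq_induced_of_eigenvector ρ (fun X hX ↦ hirr X fun s _ ↦ hX s) K v hv hK
    hidx⟩

end AlmostMonomial

theorem theorem53 {G : Type*} [Group G] [Finite G] (N : Subgroup G) [N.Normal]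
    (hG : Group.IsSolvable G)
    (hN : ∀ (p : ℕ) [Fact p.Prime] (P : Sylow p N), IsMulCommutative P)
    (hrel : AlmostMonomial.IsRelativeAlmostMonomial G N) :
    AlmostMonomial.IsAlmostMonomial G := by
  intro χ hχ φ hφ hne
  obtain ⟨H, hNH, ψ, hψ, hψN, h1, h2⟩ := hrel χ hχ φ hφ hne
  obtain ⟨K, lam, hlam, rfl⟩ := AlmostMonomial.exists_eq_induced_linear hN hNH hψ hψN
  obtain ⟨L, mu, hmu, hL⟩ := AlmostMonomial.exists_induced_eq_induced_induced H K hlam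
  exact ⟨L, mu, hmu, hL ▸ h1, hL ▸ h2⟩
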